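/- Let $q>2$ be a prime power, let $n\ge 2$, and let $k$ be the largest divisor of $n$ with $k\neq n$. A pseudo-cap in $\mathrm{PG}(4n-1,q)$ is a set of $(n-1)$-spaces such that any three distinct elements span a $(3n-1)$-space. For an $\mathbb{F}_q$-linear isomorphism $\varphi$ from the underlying vector space of $\mathrm{PG}(rn-1,q)$ to $\mathbb{F}_{q^n}^{\,r}$, field reduction sends a point of $\mathrm{PG}(r-1,q^n)$ (a one-dimensional $\mathbb{F}_{q^n}$-subspace of $\mathbb{F}_{q^n}^{\,r}$) to the $(n-1)$-space of $\mathrm{PG}(rn-1,q)$ given by its preimage under $\varphi$. A Desarguesian spread of $\mathrm{PG}(rn-1,q)$ is the set of the images of all points of $\mathrm{PG}(r-1,q^n)$ under such a field reduction. A pseudo-cap in $\mathrm{PG}(4n-1,q)$ is elementary if it is the image, under such a field reduction, of a cap of $\mathrm{PG}(3,q^n)$, that is, of a set of points any three distinct elements of which span a plane. An element $E$ of a pseudo-cap $\mathcal{E}$ induces the partial spread $\{\langle E,E'\rangle/E : E'\in\mathcal{E}\setminus\{E\}\}$ in the quotient space $\mathrm{PG}(4n-1,q)/E\cong\mathrm{PG}(3n-1,q)$,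 and this partial spread extends to a Desarguesian spread if it is contained in one. Let $\mathcal{E}$ be a pseudo-cap in $\mathrm{PG}(4n-1,q)$ with $|\mathcal{E}|>q^{n+k}+q^n-q^k+1$ if $q$ is odd, and $|\mathcal{E}|>q^{n+k}+q^n+2$ if $q$ is even. Then $\mathcal{E}$ is elementary if and only if $\mathcal{E}$ has two distinct elements each of which induces a partial spread that extends to a Desarguesian spread. -/

import Mathlib

/-!
The projective space `PG(N - 1, q)` is the projective space of an `N`-dimensional vector space `V`
over a field `F` with `q` elements. Its `(d - 1)`-spaces are the `F`-subspaces of `V` of vector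
space dimension `d`, and the span of two of them is their join `⊔`.
-/

/-- A *cap* in the projective space of the `L`-vector space `W`: a set of points such that every
three (distinct) points span a plane, that is, a subspace of vector space dimension `3`. -/
def IsCap {L W : Type*} [Field L] [AddCommGroup W] [Module L W]
    (C : Set (Projectivization L W)) : Prop :=
  ∀ P ∈ C, ∀ Q ∈ C, ∀ R ∈ C, P ≠ Q → P ≠ R → Q ≠ R →
    Module.finrank L ↥(P.submodule ⊔ Q.submodule ⊔ R.submodule) = 3

/-- A *pseudo-cap* of `(n - 1)`-spaces in the projective space of `V`: a set of `(n - 1)`-spaces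
any three (distinct) elements of which span a `(3 n - 1)`-space. -/
def IsPseudoCap {F V : Type*} [Field F] [AddCommGroup V] [Module F V]
    (n : ℕ) (E : Set (Submodule F V)) : Prop :=
  (∀ A ∈ E, Module.finrank F A = n) ∧
    ∀ A ∈ E, ∀ B ∈ E, ∀ C ∈ E, A ≠ B → A ≠ C → B ≠ C →
      Module.finrank F ↥(A ⊔ B ⊔ C) = 3 * n

/-- *Field reduction* of a point `P` of `PG(r - 1, L)`, where `L` is a finite extension of `F`:
the `L`-line of `L ^ r` that is the point `P`, regarded as an `F`-subspace and transported to `V`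
through an `F`-linear identification `φ` of `V` with `L ^ r`. -/
def fieldReduction {F L V : Type*} [Field F] [Field L] [Algebra F L] [AddCommGroup V] [Module F V]
    {r : ℕ} (φ : V ≃ₗ[F] (Fin r → L)) (P : Projectivization L (Fin r → L)) : Submodule F V :=
  (P.submodule.restrictScalars F).comap φ.toLinearMap

/-- A *Desarguesian spread* in the projective space of `V`: the set of the field reductions of all
points of `PG(r - 1, L)`. -/
def IsDesarguesianSpread {F V : Type*} (L : Type*) [Field F] [Field L] [Algebra F L]
    [AddCommGroup V] [Module F V] (D : Set (Submodule F V)) : Prop :=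
  ∃ (r : ℕ) (φ : V ≃ₗ[F] (Fin r → L)), D = Set.range (fieldReduction φ)

/-- A set of subspaces is *elementary* if it is obtained by field reduction from a cap of
`PG(r - 1, L)`. -/
def IsElementary {F V : Type*} (L : Type*) [Field F] [Field L] [Algebra F L]
    [AddCommGroup V] [Module F V] (E : Set (Submodule F V)) : Prop :=
  ∃ (r : ℕ) (φ : V ≃ₗ[F] (Fin r → L)) (C : Set (Projectivization L (Fin r → L))),
    IsCap C ∧ E = fieldReduction φ '' C

/-- The partial spread *induced* by the element `A` of `E`: the images of the other elements of `E`
in the quotient space `V / A`. -/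
def inducedPartialSpread {F V : Type*} [Field F] [AddCommGroup V] [Module F V]
    (E : Set (Submodule F V)) (A : Submodule F V) : Set (Submodule F (V ⧸ A)) :=
  (fun B => B.map A.mkQ) '' (E \ {A})

/-- A set of subspaces *extends to a Desarguesian spread*. -/
def ExtendsToDesarguesianSpread {F V : Type*} (L : Type*) [Field F] [Field L] [Algebra F L]
    [AddCommGroup V] [Module F V] (S : Set (Submodule F V)) : Prop :=
  ∃ D : Set (Submodule F V), IsDesarguesianSpread L D ∧ S ⊆ D

/-! A Desarguesian spread is the set of lines of an `L`-structure, an algebra homomorphism from `L`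
to the `F`-endomorphisms. So E is elementary exactly when `V` carries an `L`-structure with all
elements of E as lines (`isElementary_iff`), and such a structure descends to each quotient `V ⧸ A`.

Conversely, structures on `V ⧸ A` and `V ⧸ B` both descend to `V ⧸ (A ⊔ B)`, of dimension 2n, where
the images of the other elements are lines of both. Elements with equal image form, with A and B, a
pseudo-arc of at most q^n + 2 elements, or q^n + 1 for odd q, so the size of E forces more than q^k
+ 1 images (`IsPseudoCap.lt_card_image`). Slopes of common lines are common scalars of the two
structures; these form a subfield of degree greater than k, hence all of `L`
(`exists_algHom_of_card_lt`). After a twist by an endomorphism of `L` the structures agree on `V ⧸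
(A ⊔ B)` and glue to one on `V`. It preserves each further C because (A ⊔ C) ⊓ (B ⊔ C) = C. -/

open Module

/-- For an `L`-vector space structure on `W` given by `ρ`, the `F`-subspace `S` is an `L`-line. -/
def IsLineOf {F L W : Type*} [Field F] [Field L] [Algebra F L] [AddCommGroup W] [Module F W]
    (ρ : L →ₐ[F] Module.End F W) (S : Submodule F W) : Prop :=
  (∀ l, ∀ x ∈ S, ρ l x ∈ S) ∧ finrank F S = finrank F L

/-! ### `L`-structures, their lines, and Desarguesian spreads. -/

section Lines

variable {F L W : Type*} [Field F] [Field L] [Algebra F L] [AddCommGroup W] [Module F W]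
  {ρ : L →ₐ[F] Module.End F W} {S T : Submodule F W}

theorem algHom_apply_eq_zero {l : L} (hl : l ≠ 0) {x : W} (h : ρ l x = 0) : x = 0 := by
  have : ρ (l⁻¹ * l) x = 0 := by rw [map_mul, Module.End.mul_apply, h, map_zero]
  rwa [inv_mul_cancel₀ hl, map_one, Module.End.one_apply] at this

theorem algHom_apply_inj {l m : L} {x : W} (hx : x ≠ 0) (h : ρ l x = ρ m x) : l = m := by
  by_contra hlm
  refine hx (algHom_apply_eq_zero (ρ := ρ) (sub_ne_zero.2 hlm) ?_)
  rw [map_sub, LinearMap.sub_apply, h, sub_self]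

/-- The orbit map of a nonzero vector is injective between spaces of equal dimension. -/
theorem IsLineOf.exists_apply_eq [Module.Finite F L] (hS : IsLineOf ρ S) {x y : W} (hx : x ∈ S)
    (hx0 : x ≠ 0) (hy : y ∈ S) : ∃ l, ρ l x = y := by
  have hpos : 0 < finrank F L := finrank_pos
  have : Module.Finite F S := Module.finite_of_finrank_pos (hS.2 ▸ hpos)
  let f : L →ₗ[F] S := ((LinearMap.applyₗ x).comp ρ.toLinearMap).codRestrict S
    fun l => hS.1 l x hx
  have hf : Function.Injective f := fun l m h =>
    algHom_apply_inj (ρ := ρ) hx0 (congrArg Subtype.val h)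
  obtain ⟨l, hl⟩ := (LinearMap.injective_iff_surjective_of_finrank_eq_finrank hS.2.symm).1 hf ⟨y, hy⟩
  exact ⟨l, congrArg Subtype.val hl⟩

theorem IsLineOf.le_of_mem [Module.Finite F L] (hS : IsLineOf ρ S) (hT : IsLineOf ρ T) {x : W}
    (hx : x ∈ S) (hxT : x ∈ T) (hx0 : x ≠ 0) : S ≤ T := fun y hy => by
  obtain ⟨l, rfl⟩ := hS.exists_apply_eq hx hx0 hy
  exact hT.1 l x hxT

theorem IsLineOf.eq_of_mem [Module.Finite F L] (hS : IsLineOf ρ S) (hT : IsLineOf ρ T) {x : W}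
    (hx : x ∈ S) (hxT : x ∈ T) (hx0 : x ≠ 0) : S = T :=
  le_antisymm (hS.le_of_mem hT hx hxT hx0) (hT.le_of_mem hS hxT hx hx0)

theorem IsLineOf.inf_eq_bot [Module.Finite F L] (hS : IsLineOf ρ S) (hT : IsLineOf ρ T)
    (h : S ≠ T) : S ⊓ T = ⊥ := by
  rw [Submodule.eq_bot_iff]
  rintro x ⟨hx, hxT⟩
  by_contra hx0
  exact h (hS.eq_of_mem hT hx hxT hx0)

theorem IsLineOf.sup_eq_top [Module.Finite F L] [Module.Finite F W] (hS : IsLineOf ρ S)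
    (hT : IsLineOf ρ T) (h : S ≠ T) (hW : finrank F W = 2 * finrank F L) : S ⊔ T = ⊤ := by
  have := Submodule.finrank_sup_add_finrank_inf_eq S T
  rw [hS.inf_eq_bot hT h, finrank_bot, hS.2, hT.2] at this
  exact Submodule.eq_top_of_finrank_eq (by omega)

theorem IsLineOf.exists_ne_zero [Module.Finite F L] (hS : IsLineOf ρ S) : ∃ x ∈ S, x ≠ 0 := by
  refine (Submodule.ne_bot_iff S).1 ?_
  rintro rfl
  have := hS.2
  have hpos : 0 < finrank F L := finrank_pos
  rw [finrank_bot] at this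
  omega

/-- Transport of an `L`-structure along a surjection with invariant kernel. -/
theorem exists_algHom_of_surjective {U : Type*} [AddCommGroup U] [Module F U]
    (ρ : L →ₐ[F] Module.End F W) (f : W →ₗ[F] U) (hf : Function.Surjective f)
    (hker : ∀ l x, f x = 0 → f (ρ l x) = 0) :
    ∃ ρ' : L →ₐ[F] Module.End F U, ∀ l x, ρ' l (f x) = f (ρ l x) := by
  obtain ⟨g, hg⟩ := f.exists_rightInverse_of_surjective (LinearMap.range_eq_top.2 hf)
  have hg' : ∀ u, f (g u) = u := fun u => LinearMap.congr_fun hg u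
  -- The choice of section is harmless: g (f x) and x differ by an element of the invariant kernel.
  have key : ∀ l x, f (ρ l (g (f x))) = f (ρ l x) := fun l x => by
    rw [← sub_eq_zero, ← map_sub, ← map_sub]
    exact hker l _ (by rw [map_sub, hg', sub_self])
  refine ⟨AlgHom.ofLinearMap
    { toFun := fun l => f ∘ₗ ρ l ∘ₗ g
      map_add' := fun a b => by ext u; simp
      map_smul' := fun a b => by ext u; simp } ?_ ?_, fun l x => key l x⟩
  · ext u
    simp [hg']
  · intro a b
    ext u
    change f (ρ (a * b) (g u)) = f (ρ a (g (f (ρ b (g u)))))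
    rw [key, map_mul, Module.End.mul_apply]

/-- Transport of an `L`-structure along an injection with invariant range. -/
theorem exists_algHom_of_injective {U : Type*} [AddCommGroup U] [Module F U]
    (ρ : L →ₐ[F] Module.End F U) (f : W →ₗ[F] U) (hf : Function.Injective f)
    (hrange : ∀ l x, ∃ y, f y = ρ l (f x)) :
    ∃ ρ' : L →ₐ[F] Module.End F W, ∀ l x, f (ρ' l x) = ρ l (f x) := by
  obtain ⟨g, hg⟩ := f.exists_leftInverse_of_injective (LinearMap.ker_eq_bot.2 hf)
  have hg' : ∀ u, g (f u) = u := fun u => LinearMap.congr_fun hg u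
  have key : ∀ l x, f (g (ρ l (f x))) = ρ l (f x) := fun l x => by
    obtain ⟨y, hy⟩ := hrange l x
    rw [← hy, hg']
  refine ⟨AlgHom.ofLinearMap
    { toFun := fun l => g ∘ₗ ρ l ∘ₗ f
      map_add' := fun a b => by ext u; simp
      map_smul' := fun a b => by ext u; simp } ?_ ?_, fun l x => key l x⟩
  · ext u
    simp [hg']
  · intro a b
    ext u
    change g (ρ (a * b) (f u)) = g (ρ a (f (g (ρ b (f u)))))
    rw [key, map_mul, Module.End.mul_apply]

theorem isLineOf_fieldReduction {r : ℕ} (φ : W ≃ₗ[F] (Fin r → L))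
    (hφ : ∀ l x, φ (ρ l x) = l • φ x) (P : Projectivization L (Fin r → L)) :
    IsLineOf ρ (fieldReduction φ P) := by
  refine ⟨fun l x hx => ?_, ?_⟩
  · change φ (ρ l x) ∈ P.submodule
    rw [hφ]
    exact P.submodule.smul_mem l hx
  · have h1 : finrank F (fieldReduction φ P) = finrank F P.submodule :=
      (φ.submoduleMap (fieldReduction φ P)).finrank_eq.trans <| by
        unfold fieldReduction
        rw [show Submodule.map (φ : W →ₗ[F] (Fin r → L)) _ = P.submodule.restrictScalars F from
          Submodule.map_comap_eq_of_surjective φ.surjective _]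
        rfl
    rw [h1, ← finrank_mul_finrank F L P.submodule, P.finrank_submodule, mul_one]

theorem exists_algHom_of_linearEquiv (L : Type*) [Field L] [Algebra F L] {r : ℕ}
    (φ : W ≃ₗ[F] (Fin r → L)) :
    ∃ ρ : L →ₐ[F] Module.End F W, ∀ l x, φ (ρ l x) = l • φ x :=
  exists_algHom_of_injective (Algebra.lsmul F F (Fin r → L)) φ.toLinearMap φ.injective
    fun _ _ => φ.surjective _

theorem exists_linearEquiv_of_algHom [Module.Finite F L] [Module.Finite F W]
    (ρ : L →ₐ[F] Module.End F W) :
    ∃ (r : ℕ) (φ : W ≃ₗ[F] (Fin r → L)), ∀ l x, φ (ρ l x) = l • φ x := by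
  let _ : Module L W := Module.compHom W ρ.toRingHom
  have hsmul : ∀ (l : L) (x : W), l • x = ρ l x := fun _ _ => rfl
  have : IsScalarTower F L W := ⟨fun a l x => by rw [hsmul, hsmul, map_smul]; rfl⟩
  have : Module.Finite L W := Module.Finite.of_restrictScalars_finite F L W
  exact ⟨_, (finBasis L W).equivFun.restrictScalars F,
    fun l x => (finBasis L W).equivFun.map_smul l x⟩

theorem IsLineOf.exists_fieldReduction_eq [Module.Finite F L] (hS : IsLineOf ρ S) {r : ℕ}
    (φ : W ≃ₗ[F] (Fin r → L)) (hφ : ∀ l x, φ (ρ l x) = l • φ x) :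
    ∃ P, fieldReduction φ P = S := by
  obtain ⟨x, hx, hx0⟩ := hS.exists_ne_zero
  refine ⟨Projectivization.mk L (φ x) (φ.map_ne_zero_iff.2 hx0), ?_⟩
  refine (isLineOf_fieldReduction φ hφ _).eq_of_mem hS (x := x) ?_ hx hx0
  change φ x ∈ (Projectivization.mk L (φ x) _).submodule
  rw [Projectivization.submodule_mk]
  exact Submodule.mem_span_singleton_self _

/-- This replaces coordinates by actions of `L`, which can be pushed to quotients, twisted and
glued. -/
theorem extendsToDesarguesianSpread_iff [Module.Finite F L] [Module.Finite F W]
    {𝒮 : Set (Submodule F W)} :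
    ExtendsToDesarguesianSpread L 𝒮 ↔ ∃ ρ : L →ₐ[F] Module.End F W, ∀ S ∈ 𝒮, IsLineOf ρ S := by
  constructor
  · rintro ⟨_, ⟨r, φ, rfl⟩, h⟩
    obtain ⟨ρ, hρ⟩ := exists_algHom_of_linearEquiv L φ
    refine ⟨ρ, fun S hS => ?_⟩
    obtain ⟨P, rfl⟩ := h hS
    exact isLineOf_fieldReduction φ hρ P
  · rintro ⟨ρ, h⟩
    obtain ⟨r, φ, hφ⟩ := exists_linearEquiv_of_algHom ρ
    exact ⟨_, ⟨r, φ, rfl⟩, fun S hS => (h S hS).exists_fieldReduction_eq φ hφ⟩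

theorem fieldReduction_injective {r : ℕ} (φ : W ≃ₗ[F] (Fin r → L)) :
    Function.Injective (fieldReduction φ) := fun P Q h => by
  apply Projectivization.submodule_injective
  have := Submodule.comap_injective_of_surjective φ.surjective h
  exact Submodule.restrictScalars_injective F _ _ this

/-- The cap condition comes for free: dimensions over `F` are n times those over `L`, so the 3n of a
pseudo-cap becomes 3. -/
theorem isElementary_iff [Module.Finite F L] [Module.Finite F W] {E : Set (Submodule F W)}
    (hE : IsPseudoCap (finrank F L) E) :
    IsElementary L E ↔ ∃ ρ : L →ₐ[F] Module.End F W, ∀ S ∈ E, IsLineOf ρ S := by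
  constructor
  · rintro ⟨r, φ, C, -, rfl⟩
    obtain ⟨ρ, hρ⟩ := exists_algHom_of_linearEquiv L φ
    refine ⟨ρ, ?_⟩
    rintro _ ⟨P, -, rfl⟩
    exact isLineOf_fieldReduction φ hρ P
  · rintro ⟨ρ, h⟩
    obtain ⟨r, φ, hφ⟩ := exists_linearEquiv_of_algHom ρ
    refine ⟨r, φ, fieldReduction φ ⁻¹' E, ?_, ?_⟩
    · intro P hP Q hQ R hR hPQ hPR hQR
      have hinj := fieldReduction_injective (F := F) φ
      have h3 := hE.2 _ hP _ hQ _ hR (hinj.ne hPQ) (hinj.ne hPR) (hinj.ne hQR)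
      have hsup : fieldReduction φ P ⊔ fieldReduction φ Q ⊔ fieldReduction φ R =
          ((P.submodule ⊔ Q.submodule ⊔ R.submodule).restrictScalars F).comap φ.toLinearMap := by
        simp only [fieldReduction, Submodule.restrictScalars_sup]
        simp only [← Submodule.map_equiv_eq_comap_symm, Submodule.map_sup,
          show φ.toLinearMap = φ.symm.symm.toLinearMap from rfl]
      have hfr : finrank F ↥(fieldReduction φ P ⊔ fieldReduction φ Q ⊔ fieldReduction φ R) =
          finrank F ↥(P.submodule ⊔ Q.submodule ⊔ R.submodule) := by
        rw [hsup]
        refine (φ.submoduleMap _).finrank_eq.trans ?_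
        rw [show Submodule.map (φ : W →ₗ[F] (Fin r → L)) _ =
          (P.submodule ⊔ Q.submodule ⊔ R.submodule).restrictScalars F from
          Submodule.map_comap_eq_of_surjective φ.surjective _]
        rfl
      rw [hfr, ← finrank_mul_finrank F L, mul_comm] at h3
      exact Nat.eq_of_mul_eq_mul_right finrank_pos h3
    · rw [Set.image_preimage_eq_of_subset]
      exact fun S hS => (h S hS).exists_fieldReduction_eq φ hφ

end Lines

/-! ### Two line spreads with many common elements. -/

section CommonLines

variable {F L X : Type*} [Field F] [Field L] [Algebra F L] [AddCommGroup X] [Module F X]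

/-- The scalars of the `L`-structure `ρ` that act as scalars of the `L`-structure `τ`. -/
def commonScalars (ρ τ : L →ₐ[F] Module.End F X) (hτ : Function.Injective τ) :
    IntermediateField F L where
  carrier := {l | ∃ m, ρ l = τ m}
  mul_mem' := by
    rintro a b ⟨m, hm⟩ ⟨k, hk⟩
    exact ⟨m * k, by rw [map_mul, map_mul, hm, hk]⟩
  add_mem' := by
    rintro a b ⟨m, hm⟩ ⟨k, hk⟩
    exact ⟨m + k, by rw [map_add, map_add, hm, hk]⟩
  algebraMap_mem' a := ⟨algebraMap F L a, by rw [AlgHom.commutes, AlgHom.commutes]⟩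
  inv_mem' := by
    rintro a ⟨m, hm⟩
    by_cases ha : a = 0
    · exact ⟨0, by simp [ha]⟩
    refine ⟨m⁻¹, ?_⟩
    have hm0 : m ≠ 0 := by
      rintro rfl
      refine ha ?_
      by_contra ha0
      have h1 : (1 : Module.End F X) = 0 := by
        rw [← map_one ρ, ← mul_inv_cancel₀ ha0, map_mul, hm, map_zero, zero_mul]
      exact one_ne_zero (hτ (by rw [map_one, h1, map_zero]))
    calc ρ a⁻¹ = ρ a⁻¹ * (τ m * τ m⁻¹) := by rw [← map_mul, mul_inv_cancel₀ hm0, map_one, mul_one]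
      _ = τ m⁻¹ := by rw [← mul_assoc, ← hm, ← map_mul, inv_mul_cancel₀ ha, map_one, one_mul]

variable [Module.Finite F L]

/-- Take `S₀` and `T` as axes and `S₁` as the unit line. The line `S` meets e + T in one point,
whose slopes for ρ and τ are l and m. The common lines force the two slopes to act identically. -/
theorem exists_mem_commonScalars [Module.Finite F X] {ρ τ : L →ₐ[F] Module.End F X}
    (hX : finrank F X = 2 * finrank F L)
    {S₀ S₁ T S : Submodule F X} (hS₀ : IsLineOf ρ S₀) (hS₁ : IsLineOf ρ S₁) (hT : IsLineOf ρ T)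
    (hS : IsLineOf ρ S) (hS₀' : IsLineOf τ S₀) (hS₁' : IsLineOf τ S₁) (hT' : IsLineOf τ T)
    (hS' : IsLineOf τ S) (h01 : S₀ ≠ S₁) (h0T : S₀ ≠ T) (h1T : S₁ ≠ T) (hST : S ≠ T)
    {e t : X} (he : e ∈ S₀) (he0 : e ≠ 0) (ht : t ∈ T) (ht0 : t ≠ 0) (het : e + t ∈ S₁) :
    ∃ l m, ρ l = τ m ∧ e + ρ l t ∈ S := by
  have zero_of {A B : Submodule F X} (hA : IsLineOf ρ A) (hB : IsLineOf ρ B) (hAB : A ≠ B) {x : X}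
      (hxA : x ∈ A) (hxB : x ∈ B) : x = 0 := by
    by_contra h0
    exact hAB (hA.eq_of_mem hB hxA hxB h0)
  obtain ⟨u, hu, v, hv, huv⟩ := Submodule.mem_sup.1
    ((hS.sup_eq_top hT hST hX).symm ▸ Submodule.mem_top : e ∈ S ⊔ T)
  obtain ⟨l, hl⟩ := hT.exists_apply_eq ht ht0 (T.neg_mem hv)
  obtain ⟨m, hm⟩ := hT'.exists_apply_eq ht ht0 (T.neg_mem hv)
  have heu : e + -v = u := by rw [← huv]; abel
  -- the two actions agree at `e` whenever they agree at `t`, and conversely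
  have move {a b : L} (hab : ρ a t = τ b t) : ρ a e = τ b e := by
    rw [← sub_eq_zero]
    refine zero_of hS₀ hS₁ h01 (S₀.sub_mem (hS₀.1 _ _ he) (hS₀'.1 _ _ he)) ?_
    have := S₁.sub_mem (hS₁.1 a _ het) (hS₁'.1 b _ het)
    rwa [map_add, map_add, hab, add_sub_add_right_eq_sub] at this
  have move' {a b : L} (hab : ρ a e = τ b e) : ρ a t = τ b t := by
    rw [← sub_eq_zero]
    refine zero_of hT hS₁ h1T.symm (T.sub_mem (hT.1 _ _ ht) (hT'.1 _ _ ht)) ?_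
    have := S₁.sub_mem (hS₁.1 a _ het) (hS₁'.1 b _ het)
    rwa [map_add, map_add, hab, add_sub_add_left_eq_sub] at this
  -- Write y = ρ a t = τ b t. Then a and b agree at e, and stability of `S` carries this agreement
  -- to ρ l t = τ m t; commutativity of `L` exchanges the two scalars.
  have onT : ∀ y ∈ T, ρ l y = τ m y := fun y hy => by
    obtain ⟨a, rfl⟩ := hT.exists_apply_eq ht ht0 hy
    obtain ⟨b, hb⟩ := hT'.exists_apply_eq ht ht0 hy
    have hae := move hb.symm
    have h1 : ρ a (ρ l t) = τ b (τ m t) := by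
      rw [← sub_eq_zero, hl, hm]
      refine zero_of hS hT hST ?_ (T.sub_mem (hT.1 _ _ (T.neg_mem hv)) (hT'.1 _ _ (T.neg_mem hv)))
      have := S.sub_mem (hS.1 a _ hu) (hS'.1 b _ hu)
      rwa [← heu, map_add, map_add, hae, add_sub_add_left_eq_sub] at this
    rw [← Module.End.mul_apply, ← map_mul, mul_comm, map_mul, Module.End.mul_apply, h1, ← hb,
      ← Module.End.mul_apply, ← map_mul, mul_comm, map_mul, Module.End.mul_apply]
  have onS₀ : ∀ y ∈ S₀, ρ l y = τ m y := fun y hy => by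
    obtain ⟨a, rfl⟩ := hS₀.exists_apply_eq he he0 hy
    obtain ⟨b, hb⟩ := hS₀'.exists_apply_eq he he0 hy
    have hat := move' hb.symm
    have := onT _ (hT.1 a t ht)
    rw [← Module.End.mul_apply, ← map_mul] at this ⊢
    rw [hat, ← Module.End.mul_apply, ← map_mul] at this
    rw [← hb, ← Module.End.mul_apply, ← map_mul]
    exact move this
  refine ⟨l, m, ?_, by rwa [hl, heu]⟩
  ext x
  obtain ⟨y, hy, z, hz, rfl⟩ := Submodule.mem_sup.1
    ((hS₀.sup_eq_top hT h0T hX).symm ▸ Submodule.mem_top : x ∈ S₀ ⊔ T)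
  rw [map_add, map_add, onT z hz, onS₀ y hy]

/-- Two Desarguesian line spreads with more than `q ^ k + 1` common elements are equal: the scalars of
the one `L`-structure are scalars of the other. -/
theorem exists_algHom_of_card_lt [Finite F] [Module.Finite F X] {ρ τ : L →ₐ[F] Module.End F X}
    (hX : finrank F X = 2 * finrank F L) {k : ℕ}
    (hk : ∀ d, d ∣ finrank F L → d ≠ finrank F L → d ≤ k)
    (𝒮 : Finset (Submodule F X)) (hρ : ∀ S ∈ 𝒮, IsLineOf ρ S) (hτ : ∀ S ∈ 𝒮, IsLineOf τ S)
    (hcard : Nat.card F ^ k + 1 < 𝒮.card) :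
    ∃ σ : L →ₐ[F] L, ∀ l, ρ l = τ (σ l) := by
  classical
  have hq : 0 < Nat.card F ^ k := pow_pos Nat.card_pos _
  obtain ⟨S₀, S₁, T, h0, h1, hT, h01, h0T, h1T⟩ := Finset.two_lt_card_iff.1 (show 2 < 𝒮.card by omega)
  have hnt : Nontrivial X := by
    obtain ⟨x, -, hx⟩ := (hρ _ h0).exists_ne_zero
    exact ⟨x, 0, hx⟩
  have hinj : Function.Injective τ := τ.toRingHom.injective
  obtain ⟨s, hs, hs0⟩ := (hρ _ h1).exists_ne_zero
  obtain ⟨e, he, t, ht, het⟩ := Submodule.mem_sup.1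
    (((hρ _ h0).sup_eq_top (hρ _ hT) h0T hX).symm ▸ Submodule.mem_top : s ∈ S₀ ⊔ T)
  have he0 : e ≠ 0 := by
    rintro rfl
    rw [zero_add] at het
    exact h1T ((hρ _ h1).eq_of_mem (hρ _ hT) hs (het ▸ ht) hs0)
  have ht0 : t ≠ 0 := by
    rintro rfl
    rw [add_zero] at het
    exact h01 ((hρ _ h0).eq_of_mem (hρ _ h1) (het ▸ he) hs hs0)
  have hmem : ∀ S ∈ 𝒮.erase T, ∃ l, l ∈ commonScalars ρ τ hinj ∧ e + ρ l t ∈ S := fun S hS => by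
    obtain ⟨hST, hS⟩ := Finset.mem_erase.1 hS
    obtain ⟨l, m, hlm, h⟩ := exists_mem_commonScalars hX (hρ _ h0) (hρ _ h1) (hρ _ hT) (hρ _ hS)
      (hτ _ h0) (hτ _ h1) (hτ _ hT) (hτ _ hS) h01 h0T h1T hST he he0 ht ht0 (het ▸ hs)
    exact ⟨l, ⟨m, hlm⟩, h⟩
  choose! f hf using hmem
  have hfinL : Finite L := Module.finite_of_finite F
  -- `T` is the one line without a slope, and the slope determines every other line; hence more than
  -- q^k common scalars.
  have hle : (𝒮.erase T).card ≤ Nat.card (commonScalars ρ τ hinj) := by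
    rw [← Nat.card_eq_finsetCard]
    refine Nat.card_le_card_of_injective
      (fun S : 𝒮.erase T => (⟨f S, (hf S S.2).1⟩ : commonScalars ρ τ hinj)) ?_
    rintro ⟨A, hA⟩ ⟨B, hB⟩ hAB
    have hfAB : f A = f B := congrArg Subtype.val hAB
    refine Subtype.ext ((hρ _ (Finset.mem_of_mem_erase hA)).eq_of_mem
      (hρ _ (Finset.mem_of_mem_erase hB)) (hf A hA).2 (hfAB ▸ (hf B hB).2) fun h => ?_)
    have heT : e ∈ T := by
      rw [eq_neg_of_add_eq_zero_left h]
      exact T.neg_mem ((hρ _ hT).1 _ _ ht)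
    exact h0T ((hρ _ h0).eq_of_mem (hρ _ hT) he heT he0)
  rw [Finset.card_erase_of_mem hT, Module.natCard_eq_pow_finrank (K := F)] at hle
  have hkd : k < finrank F (commonScalars ρ τ hinj) := by
    by_contra hle'
    have := Nat.pow_le_pow_right (Nat.card_pos (α := F)) (not_lt.1 hle')
    omega
  have hdvd : finrank F (commonScalars ρ τ hinj) ∣ finrank F L :=
    ⟨_, (finrank_mul_finrank F (commonScalars ρ τ hinj) L).symm⟩
  have heq : finrank F (commonScalars ρ τ hinj) = finrank F L := by
    by_contra hne
    exact absurd (hk _ hdvd hne) (not_le.2 hkd)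
  have htop : commonScalars ρ τ hinj = ⊤ :=
    IntermediateField.eq_of_le_of_finrank_eq le_top (heq.trans IntermediateField.finrank_top'.symm)
  have : ∀ l, ∃ m, ρ l = τ m := fun l =>
    (htop.symm ▸ IntermediateField.mem_top : l ∈ commonScalars ρ τ hinj)
  -- σ is ρ followed by the inverse of τ on its range.
  refine ⟨(AlgEquiv.ofInjective τ hinj).symm.toAlgHom.comp
    (ρ.codRestrict τ.range fun l => (this l).imp fun _ h => h.symm), fun l => ?_⟩
  exact (congrArg Subtype.val ((AlgEquiv.ofInjective τ hinj).apply_symm_apply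
    (ρ.codRestrict τ.range (fun l => (this l).imp fun _ h => h.symm) l))).symm

end CommonLines

/-! ### Counting in pseudo-caps and pseudo-arcs. -/

section PseudoCaps

variable {F V : Type*} [Field F] [AddCommGroup V] [Module F V] {n : ℕ}

theorem IsPseudoCap.mono {E P : Set (Submodule F V)} (hE : IsPseudoCap n E) (h : P ⊆ E) :
    IsPseudoCap n P :=
  ⟨fun A hA => hE.1 A (h hA), fun A hA B hB C hC => hE.2 A (h hA) B (h hB) C (h hC)⟩

variable [Module.Finite F V]

/-- The condition concerns triples only, so a third element C is needed: a span of dimension 3n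
leaves no room for A and B to meet. -/
theorem IsPseudoCap.finrank_sup {E : Set (Submodule F V)} (hE : IsPseudoCap n E)
    {A B C : Submodule F V} (hA : A ∈ E) (hB : B ∈ E) (hC : C ∈ E) (hAB : A ≠ B) (hAC : A ≠ C)
    (hBC : B ≠ C) : finrank F ↥(A ⊔ B) = 2 * n := by
  have h3 := hE.2 A hA B hB C hC hAB hAC hBC
  have h1 := Submodule.finrank_sup_add_finrank_inf_eq A B
  have h2 := Submodule.finrank_sup_add_finrank_inf_eq (A ⊔ B) C
  rw [hE.1 A hA, hE.1 B hB] at h1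
  rw [hE.1 C hC] at h2
  omega

theorem IsPseudoCap.inf_eq_bot {E : Set (Submodule F V)} (hE : IsPseudoCap n E)
    {A B C : Submodule F V} (hA : A ∈ E) (hB : B ∈ E) (hC : C ∈ E) (hAB : A ≠ B) (hAC : A ≠ C)
    (hBC : B ≠ C) : A ⊓ B = ⊥ := by
  have h1 := Submodule.finrank_sup_add_finrank_inf_eq A B
  rw [hE.finrank_sup hA hB hC hAB hAC hBC, hE.1 A hA, hE.1 B hB] at h1
  exact Submodule.finrank_eq_zero.1 (by omega)

theorem IsPseudoCap.sup_inf_eq_bot {E : Set (Submodule F V)} (hE : IsPseudoCap n E)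
    {A B C : Submodule F V} (hA : A ∈ E) (hB : B ∈ E) (hC : C ∈ E) (hAB : A ≠ B) (hAC : A ≠ C)
    (hBC : B ≠ C) : (A ⊔ B) ⊓ C = ⊥ := by
  have h2 := Submodule.finrank_sup_add_finrank_inf_eq (A ⊔ B) C
  rw [hE.finrank_sup hA hB hC hAB hAC hBC, hE.1 C hC, hE.2 A hA B hB C hC hAB hAC hBC] at h2
  exact Submodule.finrank_eq_zero.1 (by omega)

theorem IsPseudoCap.mem_of_mem_sup {E : Set (Submodule F V)} (hE : IsPseudoCap n E)
    {A B C : Submodule F V} (hA : A ∈ E) (hB : B ∈ E) (hC : C ∈ E) (hAB : A ≠ B) (hAC : A ≠ C)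
    (hBC : B ≠ C) {x : V} (hxB : x ∈ A ⊔ B) (hxC : x ∈ A ⊔ C) : x ∈ A := by
  obtain ⟨a, ha, c, hc, rfl⟩ := Submodule.mem_sup.1 hxC
  have hc' : c ∈ A ⊔ B := by
    simpa using (A ⊔ B).sub_mem hxB (Submodule.mem_sup_left ha)
  have : c ∈ (A ⊔ B) ⊓ C := ⟨hc', hc⟩
  rw [hE.sup_inf_eq_bot hA hB hC hAB hAC hBC, Submodule.mem_bot] at this
  rwa [this, add_zero]

open Classical in
/-- The elements of a pseudo-arc are projected from one of them onto a partial spread. -/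
theorem IsPseudoCap.card_mul_le_and [Finite F] {P : Finset (Submodule F V)}
    (hP : IsPseudoCap n (P : Set (Submodule F V))) (h3 : 2 < P.card) {T : Submodule F V}
    (hT : finrank F T = 3 * n) (hPT : ∀ C ∈ P, C ≤ T) {A : Submodule F V} (hA : A ∈ P) :
    (P.card - 1) * (Nat.card F ^ (2 * n) - Nat.card F ^ n) ≤ Nat.card F ^ (3 * n) - Nat.card F ^ n ∧
    ((P.card - 1) * (Nat.card F ^ (2 * n) - Nat.card F ^ n) =
      Nat.card F ^ (3 * n) - Nat.card F ^ n → ∀ x ∈ T, x ∉ A → ∃ C ∈ P, C ≠ A ∧ x ∈ A ⊔ C) := by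
  have hfin : Finite V := Module.finite_of_finite F
  have : Fintype V := Fintype.ofFinite V
  have hcard : ∀ S : Submodule F V, A ≤ S →
      (Finset.univ.filter fun x => x ∈ S ∧ x ∉ A).card =
        Nat.card F ^ finrank F S - Nat.card F ^ n := fun S hAS => by
    have h1 : ∀ S : Submodule F V, (Finset.univ.filter fun x => x ∈ S).card =
        Nat.card F ^ finrank F S := fun S => by
      rw [← Module.natCard_eq_pow_finrank (K := F) (V := S), ← Nat.card_eq_finsetCard]
      exact Nat.card_congr (Equiv.subtypeEquivRight (by simp))
    rw [← h1 S, ← hP.1 A hA, ← h1 A, ← Finset.card_sdiff_of_subset]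
    · congr 1
      ext x
      simp
    · intro x
      simpa using @hAS x
  -- The sets (A ⊔ C) \ A are disjoint, equally large and contained in T \ A. In case of equality
  -- they cover it.
  have hdisj : ((P.erase A : Finset _) : Set (Submodule F V)).PairwiseDisjoint
      fun C => Finset.univ.filter fun x => x ∈ A ⊔ C ∧ x ∉ A := by
    intro B hB C hC hBC
    obtain ⟨hBA, hB⟩ := Finset.mem_erase.1 hB
    obtain ⟨hCA, hC⟩ := Finset.mem_erase.1 hC
    refine Finset.disjoint_left.2 fun x hx hx' => ?_
    simp only [Finset.mem_filter, Finset.mem_univ, true_and] at hx hx'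
    exact hx.2 (hP.mem_of_mem_sup hA hB hC hBA.symm hCA.symm hBC hx.1 hx'.1)
  have hsub : (P.erase A).biUnion (fun C => Finset.univ.filter fun x => x ∈ A ⊔ C ∧ x ∉ A) ⊆
      Finset.univ.filter fun x => x ∈ T ∧ x ∉ A := by
    intro x hx
    simp only [Finset.mem_biUnion, Finset.mem_filter, Finset.mem_univ, true_and] at hx ⊢
    obtain ⟨C, hC, hx, hxA⟩ := hx
    exact ⟨sup_le (hPT A hA) (hPT C (Finset.mem_of_mem_erase hC)) hx, hxA⟩
  have hunion : ((P.erase A).biUnion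
      fun C => Finset.univ.filter fun x => x ∈ A ⊔ C ∧ x ∉ A).card =
      (P.card - 1) * (Nat.card F ^ (2 * n) - Nat.card F ^ n) := by
    rw [Finset.card_biUnion hdisj, ← Finset.card_erase_of_mem hA, ← smul_eq_mul]
    refine Finset.sum_eq_card_nsmul fun B hB => ?_
    have : 0 < ((P.erase A).erase B).card := by
      rw [Finset.card_erase_of_mem hB, Finset.card_erase_of_mem hA]
      omega
    obtain ⟨C, hC⟩ := Finset.card_pos.1 this
    simp only [Finset.mem_erase, ne_eq] at hB hC
    rw [hcard _ le_sup_left, hP.finrank_sup hA hB.2 hC.2.2 (Ne.symm hB.1) (Ne.symm hC.2.1)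
      (Ne.symm hC.1)]
  have hTcard := hT ▸ hcard T (hPT A hA)
  refine ⟨by rw [← hunion, ← hTcard]; exact Finset.card_le_card hsub, fun heq x hx hxA => ?_⟩
  have := Finset.eq_of_subset_of_card_le hsub (by rw [hunion, hTcard, heq])
  have hxm : x ∈ Finset.univ.filter fun x => x ∈ T ∧ x ∉ A := by simp [hx, hxA]
  rw [← this] at hxm
  simp only [Finset.mem_biUnion, Finset.mem_filter, Finset.mem_univ, true_and, Finset.mem_erase]
    at hxm
  obtain ⟨C, ⟨hCA, hC⟩, hxC, -⟩ := hxm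
  exact ⟨C, hC, hCA, hxC⟩

/-- The factor q^n + 1 is the size of a full spread of n-dimensional subspaces in dimension 2n. -/
theorem pow_three_mul_sub (q n : ℕ) :
    q ^ (3 * n) - q ^ n = (q ^ n + 1) * (q ^ (2 * n) - q ^ n) := by
  have e1 : q ^ (3 * n) = q ^ n * q ^ (2 * n) := by rw [← pow_add]; congr 1; ring
  have e2 : q ^ (2 * n) = q ^ n * q ^ n := by rw [← pow_add]; congr 1; ring
  rw [add_mul, Nat.mul_sub, ← e1, ← e2, one_mul]
  have : q ^ n ≤ q ^ (2 * n) := by rw [e2]; nlinarith [Nat.zero_le (q ^ n), sq_nonneg (q ^ n)]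
  have : q ^ (2 * n) ≤ q ^ (3 * n) := by rw [e1, e2]; nlinarith [Nat.zero_le (q ^ n)]
  omega

/-- A pseudo-arc in a `(3 n - 1)`-space has at most `q ^ n + 2` elements. -/
theorem IsPseudoCap.card_le [Finite F] {P : Finset (Submodule F V)}
    (hP : IsPseudoCap n (P : Set (Submodule F V))) (hn : 0 < n) {T : Submodule F V}
    (hT : finrank F T = 3 * n) (hPT : ∀ C ∈ P, C ≤ T) : P.card ≤ Nat.card F ^ n + 2 := by
  by_cases h3 : 2 < P.card
  · obtain ⟨A, hA⟩ := Finset.card_pos.1 (by omega : 0 < P.card)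
    have h := (hP.card_mul_le_and h3 hT hPT hA).1
    rw [pow_three_mul_sub] at h
    have hlt : Nat.card F ^ n < Nat.card F ^ (2 * n) :=
      Nat.pow_lt_pow_right Finite.one_lt_card (by omega)
    have := Nat.le_of_mul_le_mul_right h (by omega)
    omega
  · omega

/-- A pseudo-hyperoval in a `(3 n - 1)`-space has an even number of elements. -/
theorem IsPseudoCap.even_card [Finite F] {P : Finset (Submodule F V)}
    (hP : IsPseudoCap n (P : Set (Submodule F V))) (hn : 0 < n) {T : Submodule F V}
    (hT : finrank F T = 3 * n) (hPT : ∀ C ∈ P, C ≤ T) (hcard : P.card = Nat.card F ^ n + 2) :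
    Even P.card := by
  have hpos : 0 < Nat.card F ^ n := pow_pos Nat.card_pos _
  obtain ⟨A, B, D, hA, hB, hD, hAB, hAD, hBD⟩ := Finset.two_lt_card_iff.1 (show 2 < P.card by omega)
  have hne : ∀ C ∈ P, ∃ x ∈ C, x ≠ 0 := fun C hC => by
    refine (Submodule.ne_bot_iff C).1 ?_
    rintro rfl
    have := hP.1 _ hC
    rw [finrank_bot] at this
    omega
  obtain ⟨a, ha, ha0⟩ := hne A hA
  obtain ⟨b, hb, hb0⟩ := hne B hB
  have hinf := hP.inf_eq_bot hA hB hD hAB hAD hBD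
  have habx : a + b ∈ A ⊔ B := Submodule.add_mem_sup ha hb
  have hx : ∀ C ∈ P, a + b ∉ C := fun C hC hxC => by
    by_cases hCA : A = C
    · subst hCA
      have : b ∈ A ⊓ B := ⟨by simpa using A.sub_mem hxC ha, hb⟩
      rw [hinf, Submodule.mem_bot] at this
      exact hb0 this
    by_cases hCB : B = C
    · subst hCB
      have : a ∈ A ⊓ B := ⟨ha, by simpa using B.sub_mem hxC hb⟩
      rw [hinf, Submodule.mem_bot] at this
      exact ha0 this
    have : a + b ∈ (A ⊔ B) ⊓ C := ⟨habx, hxC⟩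
    rw [hP.sup_inf_eq_bot hA hB hC hAB hCA hCB, Submodule.mem_bot] at this
    have hb' : b ∈ A ⊓ B := ⟨by rw [eq_neg_of_add_eq_zero_right this]; exact A.neg_mem ha, hb⟩
    rw [hinf, Submodule.mem_bot] at hb'
    exact hb0 hb'
  -- With q^n + 2 elements the projection from each C is a full spread, so the vector a + b, lying
  -- in no element, gives C a partner.
  have hcover : ∀ C ∈ P, ∃ C' ∈ P, C' ≠ C ∧ a + b ∈ C ⊔ C' := fun C hC =>
    (hP.card_mul_le_and (by omega) hT hPT hC).2 (by rw [pow_three_mul_sub, hcard]; rfl) _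
      (sup_le (hPT A hA) (hPT B hB) habx) (hx C hC)
  choose g hgP hgne hgx using hcover
  -- Partners are unique, since two spans through the same element meet only in it; so pairing is an
  -- involution without fixed points.
  have hsum : ∑ C ∈ P, (1 : ZMod 2) = 0 := by
    refine Finset.sum_involution g (fun _ _ => by decide) (fun C hC _ => hgne C hC) hgP
      fun C hC => ?_
    by_contra hne
    refine hx _ (hgP C hC) (hP.mem_of_mem_sup (hgP C hC) (hgP _ (hgP C hC)) hC
      (hgne _ (hgP C hC)).symm (hgne C hC) hne (hgx _ (hgP C hC)) ?_)
    rw [sup_comm]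
    exact hgx C hC
  rw [Finset.sum_const, nsmul_one] at hsum
  exact (ZMod.natCast_eq_zero_iff_even).1 hsum

end PseudoCaps

/-! ### Projection from one or two elements, and gluing. -/

section Quotients

variable {F L V : Type*} [Field F] [Field L] [Algebra F L] [AddCommGroup V] [Module F V] {n : ℕ}

theorem mkQ_mem_map_mkQ_iff {A B : Submodule F V} {x : V} :
    A.mkQ x ∈ B.map A.mkQ ↔ x ∈ A ⊔ B := by
  rw [← Submodule.mem_comap, Submodule.comap_map_mkQ]

theorem finrank_map_mkQ {A B : Submodule F V} (h : A ⊓ B = ⊥) :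
    finrank F (B.map A.mkQ) = finrank F B := by
  rw [← LinearMap.range_domRestrict]
  refine LinearMap.finrank_range_of_inj (LinearMap.ker_eq_bot.1 ?_)
  rw [Submodule.eq_bot_iff]
  rintro ⟨x, hx⟩ hx0
  have : x ∈ A ⊓ B := ⟨by simpa using hx0, hx⟩
  rw [h, Submodule.mem_bot] at this
  exact Subtype.ext this

theorem extendsToDesarguesianSpread_inducedPartialSpread [Module.Finite F L]
    [Module.Finite F V]
    {ρ : L →ₐ[F] Module.End F V} {E : Set (Submodule F V)} (hE : ∀ S ∈ E, IsLineOf ρ S)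
    {A : Submodule F V} (hA : A ∈ E) :
    ExtendsToDesarguesianSpread L (inducedPartialSpread E A) := by
  rw [extendsToDesarguesianSpread_iff]
  obtain ⟨ρ', hρ'⟩ := exists_algHom_of_surjective ρ A.mkQ A.mkQ_surjective fun l x hx => by
    rw [Submodule.mkQ_apply, Submodule.Quotient.mk_eq_zero] at hx ⊢
    exact (hE A hA).1 l x hx
  refine ⟨ρ', ?_⟩
  rintro _ ⟨B, ⟨hB, hBA⟩, rfl⟩
  refine ⟨?_, ?_⟩
  · rintro l _ ⟨x, hx, rfl⟩
    rw [hρ']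
    exact Submodule.mem_map_of_mem ((hE B hB).1 l x hx)
  · rw [finrank_map_mkQ ((hE A hA).inf_eq_bot (hE B hB) (Ne.symm hBA)), (hE B hB).2]

open Classical in
-- A fibre lies in the 3n-dimensional space A ⊔ B ⊔ C and forms a pseudo-arc with A and B. For odd q
-- the extremal size q^n + 2 is odd, which parity forbids.
theorem IsPseudoCap.card_fiber_le [Finite F] [Module.Finite F V] {E : Finset (Submodule F V)}
    (hE : IsPseudoCap n (E : Set (Submodule F V))) (hn : 0 < n) {A B C : Submodule F V}
    (hA : A ∈ E) (hB : B ∈ E) (hC : C ∈ E) (hAB : A ≠ B) (hAC : A ≠ C) (hBC : B ≠ C) :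
    (((E.erase A).erase B).filter
      fun D => D.map (A ⊔ B).mkQ = C.map (A ⊔ B).mkQ).card ≤ Nat.card F ^ n ∧
    (Odd (Nat.card F) → (((E.erase A).erase B).filter
      fun D => D.map (A ⊔ B).mkQ = C.map (A ⊔ B).mkQ).card ≤ Nat.card F ^ n - 1) := by
  set Φ := ((E.erase A).erase B).filter fun D => D.map (A ⊔ B).mkQ = C.map (A ⊔ B).mkQ with hΦ
  have hBΦ : B ∉ Φ := by simp [hΦ]
  have hAΦ : A ∉ insert B Φ := by simp [hΦ, hAB]
  have hcard : (insert A (insert B Φ)).card = Φ.card + 2 := by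
    rw [Finset.card_insert_of_notMem hAΦ, Finset.card_insert_of_notMem hBΦ]
  have hP : IsPseudoCap n ((insert A (insert B Φ) : Finset _) : Set (Submodule F V)) := by
    refine hE.mono fun D hD => ?_
    simp only [Finset.coe_insert, Set.mem_insert_iff, Finset.mem_coe, hΦ, Finset.mem_filter,
      Finset.mem_erase] at hD
    rcases hD with rfl | rfl | hD
    exacts [hA, hB, hD.1.2.2]
  have hT := hE.2 A hA B hB C hC hAB hAC hBC
  have hPT : ∀ D ∈ insert A (insert B Φ), D ≤ A ⊔ B ⊔ C := by
    intro D hD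
    simp only [Finset.mem_insert, hΦ, Finset.mem_filter] at hD
    rcases hD with rfl | rfl | hD
    · exact le_sup_left.trans le_sup_left
    · exact le_sup_right.trans le_sup_left
    · rw [← Submodule.comap_map_mkQ, ← hD.2, Submodule.comap_map_mkQ]
      exact le_sup_right
  have hle := hP.card_le hn hT hPT
  rw [hcard] at hle
  refine ⟨by omega, fun hodd => ?_⟩
  by_contra hgt
  have heq : Φ.card + 2 = Nat.card F ^ n + 2 := by omega
  have heven := hP.even_card hn hT hPT (hcard.trans heq)
  rw [hcard, heq] at heven
  exact Nat.not_even_iff_odd.2 ((hodd.pow (n := n)).add_even even_two) heven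

open Classical in
/-- The number of elements of the partial spread induced in the quotient by the span of two
elements of a large pseudo-cap. -/
theorem IsPseudoCap.lt_card_image [Finite F] [Module.Finite F V] {E : Finset (Submodule F V)}
    (hE : IsPseudoCap n (E : Set (Submodule F V))) (hn : 0 < n) {k : ℕ}
    (hodd : Odd (Nat.card F) → (E.card : ℤ) >
      (Nat.card F : ℤ) ^ (n + k) + (Nat.card F : ℤ) ^ n - (Nat.card F : ℤ) ^ k + 1)
    (heven : Even (Nat.card F) →
      (E.card : ℤ) > (Nat.card F : ℤ) ^ (n + k) + (Nat.card F : ℤ) ^ n + 2)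
    {A B : Submodule F V} (hA : A ∈ E) (hB : B ∈ E) (hAB : A ≠ B) :
    Nat.card F ^ k + 1 <
      (((E.erase A).erase B).image fun D => D.map (A ⊔ B).mkQ).card := by
  by_contra! hle
  have hfib : ∀ S ∈ ((E.erase A).erase B).image fun D => D.map (A ⊔ B).mkQ,
      (((E.erase A).erase B).filter fun D => D.map (A ⊔ B).mkQ = S).card ≤ Nat.card F ^ n ∧
      (Odd (Nat.card F) → (((E.erase A).erase B).filter
        fun D => D.map (A ⊔ B).mkQ = S).card ≤ Nat.card F ^ n - 1) := by
    intro S hS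
    obtain ⟨C, hC, rfl⟩ := Finset.mem_image.1 hS
    simp only [Finset.mem_erase] at hC
    exact hE.card_fiber_le hn hA hB hC.2.2 hAB (Ne.symm hC.2.1) (Ne.symm hC.1)
  have hcard : ((E.erase A).erase B).card = E.card - 2 := by
    rw [Finset.card_erase_of_mem (Finset.mem_erase.2 ⟨hAB.symm, hB⟩), Finset.card_erase_of_mem hA]
    omega
  have hpos : 0 < Nat.card F ^ n := pow_pos Nat.card_pos _
  -- With N = q^n, or q^n - 1 for odd q, the right-hand side is exactly the threshold of the
  -- hypothesis.
  have bound {N : ℕ} (hN : ∀ S ∈ ((E.erase A).erase B).image fun D => D.map (A ⊔ B).mkQ,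
      (((E.erase A).erase B).filter fun D => D.map (A ⊔ B).mkQ = S).card ≤ N) :
      (E.card : ℤ) ≤ N * ((Nat.card F : ℤ) ^ k + 1) + 2 := by
    have h1 := (Finset.card_le_mul_card_image _ N hN).trans (Nat.mul_le_mul_left N hle)
    rw [hcard] at h1
    have h2 : E.card ≤ N * (Nat.card F ^ k + 1) + 2 := by omega
    exact_mod_cast h2
  rcases Nat.even_or_odd (Nat.card F) with he | ho
  · have h1 := bound fun S hS => (hfib S hS).1
    have h2 := heven he
    push_cast at h1
    rw [pow_add] at h2
    linarith
  · have h1 := bound fun S hS => (hfib S hS).2 ho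
    have h2 := hodd ho
    rw [Nat.cast_sub hpos] at h1
    push_cast at h1
    rw [pow_add] at h2
    linarith

/-- An `L`-structure on `V ⧸ A` with the line `⟨A, B⟩ / A` induces one on `V ⧸ ⟨A, B⟩`. -/
theorem exists_algHom_quotient_sup {A B S : Submodule F V} (hS : S = A ⊔ B)
    (hAS : A ≤ S) {ρ : L →ₐ[F] Module.End F (V ⧸ A)} (hB : IsLineOf ρ (B.map A.mkQ)) :
    ∃ ρ' : L →ₐ[F] Module.End F (V ⧸ S),
      ∀ l x, ρ' l (Submodule.factor hAS x) = Submodule.factor hAS (ρ l x) := by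
  subst hS
  have key : ∀ x, Submodule.factor hAS x = 0 ↔ x ∈ B.map A.mkQ := fun x => by
    obtain ⟨v, rfl⟩ := A.mkQ_surjective x
    rw [mkQ_mem_map_mkQ_iff]
    exact Submodule.Quotient.mk_eq_zero _
  refine exists_algHom_of_surjective ρ _ (Submodule.factor_surjective hAS) fun l x hx => ?_
  rw [key] at hx ⊢
  exact hB.1 l x hx

theorem IsLineOf.map_mkQ_of_factor {A S C : Submodule F V} (hAS : A ≤ S)
    {ρ : L →ₐ[F] Module.End F (V ⧸ A)} {ρ' : L →ₐ[F] Module.End F (V ⧸ S)}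
    (h : ∀ l x, ρ' l (Submodule.factor hAS x) = Submodule.factor hAS (ρ l x))
    (hC : IsLineOf ρ (C.map A.mkQ)) (hSC : S ⊓ C = ⊥) : IsLineOf ρ' (C.map S.mkQ) := by
  refine ⟨?_, ?_⟩
  · rintro l _ ⟨x, hx, rfl⟩
    obtain ⟨y, hy, hxy⟩ := hC.1 l _ (Submodule.mem_map_of_mem hx)
    refine ⟨y, hy, ?_⟩
    have := h l (A.mkQ x)
    rw [← hxy] at this
    exact this.symm
  · rw [finrank_map_mkQ hSC, ← hC.2,
      finrank_map_mkQ (eq_bot_iff.2 ((inf_le_inf_right C hAS).trans hSC.le))]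

/-- `V` is the fibre product of `V ⧸ A` and `V ⧸ B` over `V ⧸ ⟨A, B⟩`. -/
theorem exists_algHom_of_quotients {A B : Submodule F V} (hAB : A ⊓ B = ⊥)
    {ρA : L →ₐ[F] Module.End F (V ⧸ A)} {ρB : L →ₐ[F] Module.End F (V ⧸ B)}
    {ρ' : L →ₐ[F] Module.End F (V ⧸ (A ⊔ B))}
    (hρA : ∀ l x, ρ' l (Submodule.factor le_sup_left x) = Submodule.factor le_sup_left (ρA l x))
    (hρB : ∀ l x, ρ' l (Submodule.factor le_sup_right x) = Submodule.factor le_sup_right (ρB l x)) :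
    ∃ ρ : L →ₐ[F] Module.End F V, ∀ l x,
      A.mkQ (ρ l x) = ρA l (A.mkQ x) ∧ B.mkQ (ρ l x) = ρB l (B.mkQ x) := by
  obtain ⟨ρ, hρ⟩ := exists_algHom_of_injective
    ((LinearMap.prodMapAlgHom F (V ⧸ A) (V ⧸ B)).comp (ρA.prod ρB)) (A.mkQ.prod B.mkQ)
    (LinearMap.ker_eq_bot.1 (by rw [LinearMap.ker_prod, A.ker_mkQ, B.ker_mkQ, hAB]))
    fun l x => by
      obtain ⟨y, hy⟩ := A.mkQ_surjective (ρA l (A.mkQ x))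
      obtain ⟨z, hz⟩ := B.mkQ_surjective (ρB l (B.mkQ x))
      -- Both actions induce ρ', so y and z agree modulo A ⊔ B; then y - a = z + b represents both
      -- images at once.
      have hyz : y - z ∈ A ⊔ B := by
        rw [← Submodule.Quotient.mk_eq_zero, Submodule.Quotient.mk_sub, sub_eq_zero]
        have h1 := hρA l (A.mkQ x)
        have h2 := hρB l (B.mkQ x)
        rw [← hy] at h1
        rw [← hz] at h2
        exact h1.symm.trans h2
      obtain ⟨a, ha, b, hb, hab⟩ := Submodule.mem_sup.1 hyz
      refine ⟨y - a, Prod.ext ?_ ?_⟩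
      · change A.mkQ (y - a) = ρA l (A.mkQ x)
        rw [map_sub, hy, sub_eq_self, Submodule.mkQ_apply, Submodule.Quotient.mk_eq_zero]
        exact ha
      · change B.mkQ (y - a) = ρB l (B.mkQ x)
        rw [show y - a = z + b by rw [sub_eq_iff_eq_add, add_assoc, add_comm b, hab]; abel,
          map_add, hz, add_eq_left, Submodule.mkQ_apply, Submodule.Quotient.mk_eq_zero]
        exact hb
  exact ⟨ρ, fun l x => ⟨congrArg Prod.fst (hρ l x), congrArg Prod.snd (hρ l x)⟩⟩

end Quotients

/-! ### The characterisation of elementary pseudo-caps. -/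

theorem theorem3p4 {F L V : Type*} [Field F] [Finite F] [Field L] [Algebra F L]
    [AddCommGroup V] [Module F V]
    (q n k : ℕ) (hq : Nat.card F = q) (hq2 : 2 < q)
    (hk : IsGreatest {d : ℕ | d ∣ n ∧ d ≠ n} k)
    (hL : Module.finrank F L = n) (hV : Module.finrank F V = 4 * n)
    (E : Set (Submodule F V)) (hE : IsPseudoCap n E)
    (hodd : Odd q → (E.ncard : ℤ) > (q : ℤ) ^ (n + k) + (q : ℤ) ^ n - (q : ℤ) ^ k + 1)
    (heven : Even q → (E.ncard : ℤ) > (q : ℤ) ^ (n + k) + (q : ℤ) ^ n + 2) :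
    IsElementary L E ↔
      ∃ A ∈ E, ∃ B ∈ E, A ≠ B ∧
        ExtendsToDesarguesianSpread L (inducedPartialSpread E A) ∧
        ExtendsToDesarguesianSpread L (inducedPartialSpread E B) := by
  classical
  subst hq hL
  -- For n = 0 every positive integer would be an admissible divisor, and no greatest one would
  -- exist.
  have hn : 0 < finrank F L := by
    by_contra h0
    have h0 : finrank F L = 0 := by omega
    have := hk.2 (show k + 1 ∈ _ from ⟨h0 ▸ dvd_zero _, by omega⟩)
    omega
  have : Module.Finite F L := Module.finite_of_finrank_pos hn
  have : Module.Finite F V := Module.finite_of_finrank_pos (by omega)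
  have h1k : (1 : ℤ) ≤ (Nat.card F : ℤ) ^ k := one_le_pow₀ (by omega)
  have h1n : (3 : ℤ) ≤ (Nat.card F : ℤ) ^ finrank F L :=
    (by omega : (3 : ℤ) ≤ Nat.card F).trans (le_self_pow₀ (by omega) hn.ne')
  have hcard : 2 < E.ncard := by
    rcases Nat.even_or_odd (Nat.card F) with he | ho
    · have := heven he
      rw [pow_add] at this
      zify
      nlinarith
    · have := hodd ho
      rw [pow_add] at this
      zify
      nlinarith
  have hfin : E.Finite := Set.finite_of_ncard_pos (by omega)
  rw [isElementary_iff hE]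
  constructor
  · rintro ⟨ρ, hρ⟩
    obtain ⟨A, hA, B, hB, hAB⟩ := (Set.one_lt_ncard hfin).1 (by omega)
    exact ⟨A, hA, B, hB, hAB, extendsToDesarguesianSpread_inducedPartialSpread hρ hA,
      extendsToDesarguesianSpread_inducedPartialSpread hρ hB⟩
  rintro ⟨A, hA, B, hB, hAB, hextA, hextB⟩
  obtain ⟨ρA, hρA⟩ := extendsToDesarguesianSpread_iff.1 hextA
  obtain ⟨ρB, hρB⟩ := extendsToDesarguesianSpread_iff.1 hextB
  have lineA : ∀ C ∈ E, A ≠ C → IsLineOf ρA (C.map A.mkQ) := fun C hC hAC =>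
    hρA _ ⟨C, ⟨hC, hAC.symm⟩, rfl⟩
  have lineB : ∀ C ∈ E, B ≠ C → IsLineOf ρB (C.map B.mkQ) := fun C hC hBC =>
    hρB _ ⟨C, ⟨hC, hBC.symm⟩, rfl⟩
  obtain ⟨ρ', hρ'⟩ := exists_algHom_quotient_sup rfl le_sup_left (lineA B hB hAB)
  -- The quotient is kept as `V ⧸ (A ⊔ B)` rather than by B ⊔ A, so that ρ' and τ' act on the same
  -- space.
  obtain ⟨τ', hτ'⟩ := exists_algHom_quotient_sup (sup_comm A B) le_sup_right (lineB A hA hAB.symm)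
  lift E to Finset (Submodule F V) using hfin
  rw [Set.ncard_coe_finset] at hodd heven hcard
  obtain ⟨C₀, hC₀⟩ : ((E.erase A).erase B).Nonempty := by
    rw [← Finset.card_pos, Finset.card_erase_of_mem (Finset.mem_erase.2 ⟨hAB.symm, hB⟩),
      Finset.card_erase_of_mem hA]
    omega
  simp only [Finset.mem_erase, ne_eq, eq_comm (a := C₀)] at hC₀
  obtain ⟨hBC₀, hAC₀, hC₀⟩ := hC₀
  have hX : finrank F (V ⧸ (A ⊔ B)) = 2 * finrank F L := by
    have h1 := (A ⊔ B).finrank_quotient_add_finrank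
    rw [hE.finrank_sup hA hB hC₀ hAB hAC₀ hBC₀, hV] at h1
    omega
  obtain ⟨σ, hσ⟩ := exists_algHom_of_card_lt (ρ := ρ') (τ := τ') hX
    (fun d hd hd' => hk.2 ⟨hd, hd'⟩)
    (((E.erase A).erase B).image fun D => D.map (A ⊔ B).mkQ)
    (by
      intro S hS
      obtain ⟨C, hC, rfl⟩ := Finset.mem_image.1 hS
      simp only [Finset.mem_erase, ne_eq, eq_comm (a := C)] at hC
      exact (lineA C hC.2.2 hC.2.1).map_mkQ_of_factor _ hρ'
        (hE.sup_inf_eq_bot hA hB hC.2.2 hAB hC.2.1 hC.1))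
    (by
      intro S hS
      obtain ⟨C, hC, rfl⟩ := Finset.mem_image.1 hS
      simp only [Finset.mem_erase, ne_eq, eq_comm (a := C)] at hC
      exact (lineB C hC.2.2 hC.1).map_mkQ_of_factor _ hτ'
        (hE.sup_inf_eq_bot hA hB hC.2.2 hAB hC.2.1 hC.1))
    (hE.lt_card_image hn hodd heven hA hB hAB)
  -- Twisting by σ leaves the lines of ρB stable and makes it induce ρ'.
  obtain ⟨ρ, hρ⟩ := exists_algHom_of_quotients (ρB := ρB.comp σ)
    (hE.inf_eq_bot hA hB hC₀ hAB hAC₀ hBC₀) hρ' fun l x => by rw [hσ, hτ']; rfl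
  refine ⟨ρ, fun C hC => ⟨fun l x hx => ?_, hE.1 C hC⟩⟩
  by_cases hAC : A = C
  · subst hAC
    have h := (hρ l x).1
    rw [(Submodule.Quotient.mk_eq_zero A).2 hx |> (show A.mkQ x = 0 from ·), map_zero] at h
    exact (Submodule.Quotient.mk_eq_zero A).1 h
  by_cases hBC : B = C
  · subst hBC
    have h := (hρ l x).2
    rw [(Submodule.Quotient.mk_eq_zero B).2 hx |> (show B.mkQ x = 0 from ·), map_zero] at h
    exact (Submodule.Quotient.mk_eq_zero B).1 h
  have h1 : ρ l x ∈ A ⊔ C := by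
    rw [← mkQ_mem_map_mkQ_iff, (hρ l x).1]
    exact (lineA C hC hAC).1 l _ (Submodule.mem_map_of_mem hx)
  have h2 : ρ l x ∈ B ⊔ C := by
    rw [← mkQ_mem_map_mkQ_iff, (hρ l x).2]
    exact (lineB C hC hBC).1 (σ l) _ (Submodule.mem_map_of_mem hx)
  rw [sup_comm] at h1 h2
  exact hE.mem_of_mem_sup hC hA hB (Ne.symm hAC) (Ne.symm hBC) hAB h1 h2
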